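/- Let $\mathsf A$ be a Grothendieck abelian category, that is, an abelian category with (small) filtered colimits in which filtered colimits are exact and which has a generator. For a regular cardinal $\alpha$, an object $X$ of $\mathsf A$ is called $\alpha$-presentable if $\operatorname{Hom}_{\mathsf A}(X,-)$ preserves $\alpha$-filtered colimits; $\mathsf A^\alpha$ denotes the full subcategory of $\alpha$-presentable objects. A cocomplete category $\mathsf A$ is called locally $\alpha$-presentable if $\mathsf A^\alpha$ is essentially small and every object of $\mathsf A$ is an $\alpha$-filtered colimit of $\alpha$-presentable objects, and locally presentable if it is locally $\beta$-presentable for some regular cardinal $\beta$. Then $\mathsf A$ is locally presentable. Moreover, there exists a regular cardinal $\alpha$ such that $\mathsf A$ is locally $\alpha$-presentable and the category $\mathsf A^\alpha$ is abelian. -/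

import Mathlib

open CategoryTheory

universe w v u

open Limits

/-! ### Presentability of a separator. -/

namespace CategoryTheory.IsGrothendieckAbelian

variable {A : Type u} [Category.{v} A] [Abelian A] [IsGrothendieckAbelian.{w} A]

/-! A separator `G` is presentable by AB5 (`exists_isCardinalPresentable_of_isSeparator`), and,
being a strong generator, it makes the category locally `α`-presentable for large `α`. For `α = c⁺`
with `c ^ #End(G) = c`, an object `X` is `α`-presentable iff `Hom(G, X)` has at most `c` elements
(`isCardinalPresentable_iff_hasCardinalLT_hom`). This size condition passes to subobjects, finite
products and, by `hasCardinalLT_hom_of_epi`, quotients, so these objects form an abelian category.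
-/

/-- Let `p : c.pt ⟶ Z` be an epimorphism out of a filtered colimit. The morphisms `x : G ⟶ X`
such that `x ≫ g` lifts to some stage of the diagram are jointly epimorphic. -/
lemma eq_zero_of_forall_lift {G : A} (hG : IsSeparator G)
    {J : Type w} [SmallCategory J] [IsFiltered J] {Y : J ⥤ A} {c : Cocone Y} (hc : IsColimit c)
    {X Z W : A} (p : c.pt ⟶ Z) [Epi p] (g : X ⟶ Z) (u : X ⟶ W)
    (h : ∀ (j : J) (x : G ⟶ X) (y : G ⟶ Y.obj j), y ≫ c.ι.app j ≫ p = x ≫ g → x ≫ u = 0) :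
    u = 0 := by
  let z : pullback p g ⟶ c.pt := pullback.fst p g
  -- By exactness of filtered colimits, the pullback of `p` along `g` is the colimit of its
  -- stagewise pullbacks, which can be tested on `G`.
  have := IsPresentable.surjectivity.isIso_f hc z
  rw [← cancel_epi (pullback.snd p g), ← cancel_epi (IsPresentable.surjectivity.f z), comp_zero,
    comp_zero]
  refine colimit.hom_ext fun j ↦ ?_
  rw [reassoc_of% (IsPresentable.surjectivity.hf z j), comp_zero]
  refine hG.def _ _ fun k ↦ ?_
  have hj := NatTrans.congr_app (pullback.condition (f := c.ι) (g := (Functor.const J).map z)) j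
  simp only [NatTrans.comp_app, Functor.const_map_app] at hj
  rw [comp_zero]
  have := h j (k ≫ (pullback.snd c.ι ((Functor.const J).map z)).app j ≫ pullback.snd p g)
    (k ≫ (pullback.fst c.ι ((Functor.const J).map z)).app j) (by
      rw [Category.assoc, reassoc_of% hj]
      simp [z, pullback.condition])
  simpa using this

/-- A separator of a Grothendieck abelian category is presentable. -/
lemma exists_isCardinalPresentable_of_isSeparator {G : A} (hG : IsSeparator G) :
    ∃ (κ : Cardinal.{w}) (_ : Fact κ.IsRegular), IsCardinalPresentable G κ := by
  have (R : Set (G ⟶ G)) := hasCoproductsOfShape_of_small.{w} A R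
  let q (R : Set (G ⟶ G)) : ∐ (fun _ : R ↦ G) ⟶ G := Limits.Sigma.desc fun r ↦ r.1
  obtain ⟨κ, hκ, h⟩ := HasCardinalLT.exists_regular_cardinal.{w}
    ((Σ R, Subobject (kernel (q R))) ⊕ Subobject G ⊕ (G ⟶ G))
  have : Fact κ.IsRegular := ⟨hκ⟩
  have hK (R) : HasCardinalLT (Subobject (kernel (q R))) κ :=
    h.of_injective (fun x ↦ Sum.inl ⟨R, x⟩) (fun _ _ hxy ↦ by simpa using hxy)
  have hS : HasCardinalLT (Subobject G) κ :=
    h.of_injective _ (Sum.inr_injective.comp Sum.inl_injective)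
  have hE : HasCardinalLT (G ⟶ G) κ :=
    h.of_injective _ (Sum.inr_injective.comp Sum.inr_injective)
  refine ⟨κ, inferInstance, ⟨fun J _ _ ↦ ⟨fun {Y} ↦ ⟨fun {c} hc ↦ ⟨?_⟩⟩⟩⟩⟩
  have := isFiltered_of_isCardinalFiltered J κ
  refine Types.FilteredColimit.isColimitOf' _ _ (fun (z : G ⟶ c.pt) ↦ ?_)
    (IsPresentable.injectivity hc hS)
  -- Fewer than `κ` endomorphisms lift, so they lift to a common stage. They jointly cover `G`; the
  -- lift descends to `G` once a later stage kills the kernel of the cover.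
  let R : Set (G ⟶ G) := {r | ∃ (j : J) (y : G ⟶ Y.obj j), y ≫ c.ι.app j = r ≫ z}
  choose j y hy using fun r : R ↦ r.2
  have hR : HasCardinalLT R κ := hE.of_injective _ Subtype.val_injective
  let y' : ∐ (fun _ : R ↦ G) ⟶ Y.obj (IsCardinalFiltered.max j hR) :=
    Limits.Sigma.desc fun r ↦ y r ≫ Y.map (IsCardinalFiltered.toMax j hR r)
  have hy' : y' ≫ c.ι.app _ = q R ≫ z := by
    ext r
    simp [y', q, hy]
  have : Epi (q R) := Preadditive.epi_of_cancel_zero _ fun {W} u hu ↦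
    eq_zero_of_forall_lift hG hc (𝟙 _) z u fun j x y hxy ↦ by
      simpa [q] using Limits.Sigma.ι (fun _ : R ↦ G) ⟨x, j, y, by simpa using hxy⟩ ≫= hu
  obtain ⟨j', φ, hφ⟩ := IsPresentable.injectivity₀ hc (hK R) (kernel.ι (q R) ≫ y')
    (by rw [Category.assoc, hy', kernel.condition_assoc, zero_comp])
  refine ⟨j', Abelian.epiDesc (q R) (y' ≫ Y.map φ) (by simpa using hφ), ?_⟩
  change z = _ ≫ c.ι.app j'
  rw [← cancel_epi (q R), Abelian.comp_epiDesc_assoc, Category.assoc, c.w, hy']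

end CategoryTheory.IsGrothendieckAbelian

/-! ### Cardinal bounds. -/

namespace HasCardinalLT

lemma list {X : Type u} {c : Cardinal.{w}} (hc : Cardinal.aleph0 ≤ c)
    (hX : HasCardinalLT X (Order.succ c)) : HasCardinalLT (List X) (Order.succ c) := by
  have := hX.small
  rw [hasCardinalLT_iff_of_equiv (equivShrink.{w} X), hasCardinalLT_iff_cardinal_mk_lt,
    Order.lt_succ_iff] at hX
  have e : List X ≃ List (Shrink.{w} X) := Equiv.listEquivOfEquiv (equivShrink.{w} X)
  rw [hasCardinalLT_iff_of_equiv e, hasCardinalLT_iff_cardinal_mk_lt, Order.lt_succ_iff]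
  exact (Cardinal.mk_list_le_max _).trans (max_le hc hX)

lemma arrow {X : Type u} {E : Type v} [Small.{w} E] {c : Cardinal.{w}}
    (hE : c ^ Cardinal.mk (Shrink.{w} E) ≤ c)
    (hX : HasCardinalLT X (Order.succ c)) : HasCardinalLT (E → X) (Order.succ c) := by
  have := hX.small
  rw [hasCardinalLT_iff_of_equiv (equivShrink.{w} X), hasCardinalLT_iff_cardinal_mk_lt,
    Order.lt_succ_iff] at hX
  rw [hasCardinalLT_iff_of_equiv (Equiv.arrowCongr (equivShrink.{w} E) (equivShrink.{w} X)),
    hasCardinalLT_iff_cardinal_mk_lt, Order.lt_succ_iff, ← Cardinal.power_def]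
  exact (Cardinal.power_le_power_right hX).trans hE

end HasCardinalLT

/-! ### Presentability as a bound on morphisms from the separator. -/

namespace CategoryTheory.IsGrothendieckAbelian

variable {A : Type u} [Category.{v} A] [Abelian A] [IsGrothendieckAbelian.{w} A]

/-- A morphism from `G` to a finite coproduct of copies of `G` is a sum of morphisms to the
summands. -/
lemma eq_sum_comp_sigma_ι {G : A} {T : Type w} [Fintype T] (y : G ⟶ ∐ (fun _ : T ↦ G)) :
    ∃ f : T → (G ⟶ G), y = ∑ t, f t ≫ Limits.Sigma.ι (fun _ : T ↦ G) t := by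
  classical
  refine ⟨fun t ↦ y ≫ Limits.Sigma.π _ t, ?_⟩
  simp_rw [Category.assoc, ← Preadditive.comp_sum]
  rw [eq_comm]
  convert Category.comp_id y
  ext s
  rw [Preadditive.comp_sum, Finset.sum_eq_single s]
  · simp
  · intro t _ hts
    rw [Limits.Sigma.ι_π_of_ne_assoc _ hts.symm, zero_comp]
  · simp

/-- If `c` is large compared to `G ⟶ G`, a quotient of a coproduct of at most `c` copies of `G` has
at most `c` morphisms from `G`. -/
lemma hasCardinalLT_hom_of_epi {G : A} (hG : IsSeparator G) {c : Cardinal.{w}}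
    (hc : Cardinal.aleph0 ≤ c) (hE : c ^ Cardinal.mk (Shrink.{w} (G ⟶ G)) ≤ c)
    (hE' : HasCardinalLT (G ⟶ G) (Order.succ c))
    {S : Type w} (hS : HasCardinalLT S (Order.succ c)) {Z : A} (z : S → (G ⟶ Z))
    [Epi (Limits.Sigma.desc z)] :
    HasCardinalLT (G ⟶ Z) (Order.succ c) := by
  classical
  have hα : Cardinal.aleph0 ≤ Order.succ c := hc.trans (Order.le_succ c)
  let φ (se : S × (G ⟶ G)) : G ⟶ Z := se.2 ≫ z se.1
  let N := AddSubmonoid.closure (Set.range φ)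
  have hN : HasCardinalLT N (Order.succ c) := by
    refine (HasCardinalLT.list hc (hasCardinalLT_prod hα hS hE')).of_surjective
      (fun l ↦ ⟨(l.map φ).sum, N.list_sum_mem fun x hx ↦ ?_⟩) ?_
    · obtain ⟨se, _, rfl⟩ := List.mem_map.1 hx
      exact AddSubmonoid.subset_closure ⟨se, rfl⟩
    · rintro ⟨x, hx⟩
      induction hx using AddSubmonoid.closure_induction with
      | mem x hx =>
        obtain ⟨se, rfl⟩ := hx
        exact ⟨[se], by simp⟩
      | zero => exact ⟨[], by simp⟩
      | add x y hx hy hx' hy' =>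
        obtain ⟨l, hl⟩ := hx'
        obtain ⟨m, hm⟩ := hy'
        refine ⟨l ++ m, ?_⟩
        rw [Subtype.ext_iff] at hl hm ⊢
        dsimp at hl hm
        simp [hl, hm]
  have hlift (T : Finset (Discrete S)) (y : G ⟶ ∐ fun t : T ↦ G) :
      y ≫ Limits.Sigma.desc (fun t : T ↦ z t.1.as) ∈ N := by
    obtain ⟨f, rfl⟩ := eq_sum_comp_sigma_ι y
    rw [Preadditive.sum_comp]
    refine sum_mem fun t _ ↦ AddSubmonoid.subset_closure ⟨(t.1.as, f t), ?_⟩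
    simp [φ]
  -- The coproduct is the filtered colimit of its finite subcoproducts, so the `r` with `r ≫ g ∈ N`
  -- are jointly epimorphic and this partial function determines `g`.
  let code (g : G ⟶ Z) (r : G ⟶ G) : Option N := if h : r ≫ g ∈ N then some ⟨_, h⟩ else none
  refine (HasCardinalLT.arrow hE ((hasCardinalLT_option_iff N _ hα).2 hN)).of_injective code ?_
  intro g g' hgg'
  rw [← sub_eq_zero]
  let p : (CoproductsFromFiniteFiltered.finiteSubcoproductsCocone fun _ : S ↦ G).pt ⟶ Z :=
    Limits.Sigma.desc z
  have : Epi p := ‹Epi (Limits.Sigma.desc z)›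
  refine eq_zero_of_forall_lift hG
    (CoproductsFromFiniteFiltered.isColimitFiniteSubproductsCocone (fun _ : S ↦ G))
    p g _ fun T x y hxy ↦ ?_
  have hx : x ≫ g ∈ N := by
    rw [← hxy]
    convert hlift T y using 2
    refine y ≫= Limits.Sigma.hom_ext _ _ fun t ↦ ?_
    exact (Limits.Sigma.ι_desc_assoc _ _ _).trans
      ((Limits.Sigma.ι_desc _ _).trans
        (Limits.Sigma.ι_desc (f := fun _ : T ↦ G) (fun t : T ↦ z t.1.as) t).symm)
  have h := congr_fun hgg' x
  simp only [code, dif_pos hx] at h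
  split_ifs at h with h'
  rw [Preadditive.comp_sub, sub_eq_zero]
  simpa using h

omit [IsGrothendieckAbelian.{w} A] in
lemma isStrongGenerator_singleton {G : A} (hG : IsSeparator G) :
    (ObjectProperty.singleton G).IsStrongGenerator :=
  ObjectProperty.isStrongGenerator_iff.2 ⟨hG, fun X Y i _ hi ↦ hG.isDetector i fun G' hG' h ↦ by
    obtain ⟨h', hh'⟩ := hi G' hG' h
    exact ⟨h', hh', fun h'' hh'' ↦ by rw [← cancel_mono i, hh'']; exact hh'.symm⟩⟩

/-- Any object is a quotient of a coproduct of copies of a separator indexed by its "points". -/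
lemma exists_epi_sigma_desc {G : A} (hG : IsSeparator G) (X : A) {κ : Cardinal.{w}}
    (hX : HasCardinalLT (G ⟶ X) κ) :
    ∃ (S : Type w) (_ : HasCardinalLT S κ) (z : S → (G ⟶ X)), Epi (Limits.Sigma.desc z) := by
  refine ⟨Shrink.{w} (G ⟶ X), (hasCardinalLT_iff_of_equiv (equivShrink _) _).1 hX,
    (equivShrink _).symm, Preadditive.epi_of_cancel_zero _ fun u hu ↦ hG.def _ _ fun h ↦ ?_⟩
  simpa using Limits.Sigma.ι (fun _ : Shrink.{w} (G ⟶ X) ↦ G) (equivShrink _ h) ≫= hu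

omit [Abelian A] [IsGrothendieckAbelian.{w} A] in
lemma hasCardinalLT_hom_of_mono {X Y : A} {κ : Cardinal.{w}} {G : A} (f : X ⟶ Y) [Mono f]
    (hY : HasCardinalLT (G ⟶ Y) κ) : HasCardinalLT (G ⟶ X) κ :=
  hY.of_injective (· ≫ f) fun _ _ h ↦ by simpa [cancel_mono] using h

/-- If `c` is large enough, the `c⁺`-presentable objects are those with at most `c` morphisms from
the separator `G`. -/
lemma isCardinalPresentable_iff_hasCardinalLT_hom {G : A} (hG : IsSeparator G) {c : Cardinal.{w}}
    (hc : Cardinal.aleph0 ≤ c) (hE : c ^ Cardinal.mk (Shrink.{w} (G ⟶ G)) ≤ c)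
    (hE' : HasCardinalLT (G ⟶ G) (Order.succ c)) [Fact (Order.succ c).IsRegular]
    [IsCardinalPresentable G (Order.succ c)] (X : A) :
    IsCardinalPresentable X (Order.succ c) ↔ HasCardinalLT (G ⟶ X) (Order.succ c) := by
  have hα : Cardinal.aleph0 ≤ Order.succ c := hc.trans (Order.le_succ c)
  have hcoprod (S : Type w) (hS : HasCardinalLT S (Order.succ c)) :
      IsCardinalPresentable (∐ fun _ : S ↦ G) (Order.succ c) := by
    have := isClosedUnderColimitsOfShape_isCardinalPresentable A
      (J := Discrete S) (κ := Order.succ c) (by simpa using hS)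
    exact (isCardinalPresentable A (Order.succ c)).prop_colimit _ fun _ ↦ by
      dsimp; assumption
  constructor
  · intro hX
    -- Presentable objects are generated from `G` by small colimits, which are quotients of small
    -- coproducts of `G` when the diagram satisfies the bound.
    have := IsStrongGenerator.colimitsCardinalClosure_eq_isCardinalPresentable
      (κ := Order.succ c) (isStrongGenerator_singleton hG)
      (by simpa [isCardinalPresentable_iff])
    rw [← isCardinalPresentable_iff, this] at hX
    let Q : ObjectProperty A := fun X ↦ HasCardinalLT (G ⟶ X) (Order.succ c)
    have : Q.IsClosedUnderIsomorphisms := ⟨fun e h ↦ hasCardinalLT_hom_of_mono e.inv h⟩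
    refine ObjectProperty.colimitsCardinalClosure_le _ (Order.succ c) (Q := Q) ?_
      (by simpa [Q] using hE') _ hX
    refine fun J _ hJ ↦ ⟨fun X ⟨p⟩ ↦ ?_⟩
    let S := Σ j, Shrink.{w} (G ⟶ p.diag.obj j)
    have hS : HasCardinalLT S (Order.succ c) :=
      hasCardinalLT_sigma _ _ (hasCardinalLT_of_hasCardinalLT_arrow hJ) fun j ↦
        (hasCardinalLT_iff_of_equiv (equivShrink _) _).1 (p.prop_diag_obj j)
    let z (s : S) : G ⟶ X := (equivShrink _).symm s.2 ≫ p.ι.app s.1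
    have : Epi (Limits.Sigma.desc z) := Preadditive.epi_of_cancel_zero _ fun u hu ↦
      p.isColimit.hom_ext fun j ↦ hG.def _ _ fun h ↦ by
        simpa [z] using Limits.Sigma.ι (fun _ : S ↦ G) ⟨j, equivShrink _ h⟩ ≫= hu
    exact hasCardinalLT_hom_of_epi hG hc hE hE' hS z
  · intro hX
    obtain ⟨S, hS, z, _⟩ := exists_epi_sigma_desc hG X hX
    -- The coproduct, as a quotient of itself, satisfies the bound; hence so does the kernel, and
    -- `X` gets a small presentation by copies of `G`.
    have : Epi (Limits.Sigma.desc (Limits.Sigma.ι (fun _ : S ↦ G))) := by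
      rw [show Limits.Sigma.desc (Limits.Sigma.ι (fun _ : S ↦ G)) = 𝟙 _ by cat_disch]
      infer_instance
    have hK := hasCardinalLT_hom_of_mono (kernel.ι (Limits.Sigma.desc z))
      (hasCardinalLT_hom_of_epi hG hc hE hE' hS (Limits.Sigma.ι (fun _ : S ↦ G)))
    obtain ⟨S', hS', z', _⟩ := exists_epi_sigma_desc hG _ hK
    let q : (∐ fun _ : S' ↦ G) ⟶ kernel (Limits.Sigma.desc z) := Limits.Sigma.desc z'
    have hcoker := isCokernelEpiComp (Abelian.epiIsCokernelOfKernel _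
      (kernelIsKernel (Limits.Sigma.desc z))) q rfl
    have := isClosedUnderColimitsOfShape_isCardinalPresentable A
      (J := WalkingParallelPair) (κ := Order.succ c)
      (.of_le (by simp only [hasCardinalLT_aleph0_iff]; infer_instance) hα)
    exact (isCardinalPresentable A (Order.succ c)).prop_of_isColimit hcoker (by
      rintro (_ | _)
      exacts [hcoprod S' hS', hcoprod S hS])

/-- If `c` is large enough, the `c⁺`-presentable objects are closed under kernels, cokernels and
finite products. -/
lemma nonempty_abelian_isCardinalPresentable {G : A} (hG : IsSeparator G) {c : Cardinal.{w}}
    (hc : Cardinal.aleph0 ≤ c) (hE : c ^ Cardinal.mk (Shrink.{w} (G ⟶ G)) ≤ c)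
    (hE' : HasCardinalLT (G ⟶ G) (Order.succ c)) [Fact (Order.succ c).IsRegular]
    [IsCardinalPresentable G (Order.succ c)] :
    Nonempty (Abelian (isCardinalPresentable A (Order.succ c)).FullSubcategory) := by
  have hα : Cardinal.aleph0 ≤ Order.succ c := hc.trans (Order.le_succ c)
  let P := isCardinalPresentable A (Order.succ c)
  have hP (X : A) : P X ↔ HasCardinalLT (G ⟶ X) (Order.succ c) :=
    isCardinalPresentable_iff_hasCardinalLT_hom hG hc hE hE' X
  have : P.IsClosedUnderSubobjects := ⟨fun f _ hY ↦ by
    rw [hP] at hY ⊢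
    exact hasCardinalLT_hom_of_mono f hY⟩
  have : P.IsClosedUnderQuotients := ⟨fun f _ hX ↦ by
    rw [hP] at hX ⊢
    obtain ⟨S, hS, z, _⟩ := exists_epi_sigma_desc hG _ hX
    have : Epi (Limits.Sigma.desc fun s ↦ z s ≫ f) := by
      rw [show (Limits.Sigma.desc fun s ↦ z s ≫ f) = Limits.Sigma.desc z ≫ f by cat_disch]
      infer_instance
    exact hasCardinalLT_hom_of_epi hG hc hE hE' hS fun s ↦ z s ≫ f⟩
  have : P.ContainsZero := by
    obtain ⟨Z, hZ⟩ := HasZeroObject.zero (C := A)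
    have : Subsingleton (G ⟶ Z) := ⟨hZ.eq_of_tgt⟩
    exact ⟨Z, hZ, (hP _).2 (hasCardinalLT_of_finite _ _ hα)⟩
  have : P.IsClosedUnderBinaryProducts := ⟨fun X ⟨p⟩ ↦ by
    have h (j) := (hP _).1 (p.prop_diag_obj j)
    rw [hP]
    refine (hasCardinalLT_prod hα (h ⟨.left⟩) (h ⟨.right⟩)).of_injective
      (fun f ↦ (f ≫ p.π.app _, f ≫ p.π.app _)) fun f g hfg ↦ p.isLimit.hom_ext ?_
    rintro (_ | _)
    · exact congr_arg _root_.Prod.fst hfg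
    · exact congr_arg _root_.Prod.snd hfg⟩
  have : P.IsClosedUnderFiniteProducts := .mk'
  exact ⟨inferInstanceAs (Abelian P.FullSubcategory)⟩

end CategoryTheory.IsGrothendieckAbelian

theorem mainTheorem11 (A : Type u) [Category.{v} A] [Abelian A]
    [IsGrothendieckAbelian.{w} A] :
    IsLocallyPresentable.{w} A ∧
      ∃ (α : Cardinal.{w}) (_ : Fact α.IsRegular),
        IsCardinalLocallyPresentable A α ∧
          Nonempty (Abelian (isCardinalPresentable A α).FullSubcategory) := by
  let G := separator A
  have hG : IsSeparator G := isSeparator_separator A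
  obtain ⟨κ, _, _⟩ := IsGrothendieckAbelian.exists_isCardinalPresentable_of_isSeparator.{w} hG
  let e := Cardinal.mk (Shrink.{w} (G ⟶ G))
  let m : Cardinal.{w} := max Cardinal.aleph0 (max κ e)
  -- A power of two gives `c ^ e = 2 ^ (m * e) ≤ 2 ^ m = c`.
  let c : Cardinal.{w} := 2 ^ m
  have hm : Cardinal.aleph0 ≤ m := le_max_left _ _
  have hmc : m ≤ c := (Cardinal.cantor m).le
  have he : e ≤ m := (le_max_right _ _).trans (le_max_right _ _)
  have hc : Cardinal.aleph0 ≤ c := hm.trans hmc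
  have hE : c ^ e ≤ c := by
    rw [← Cardinal.power_mul]
    refine Cardinal.power_le_power_left two_ne_zero ?_
    exact (mul_le_mul_right he m).trans (Cardinal.mul_eq_self hm).le
  have hE' : HasCardinalLT (G ⟶ G) (Order.succ c) := by
    rw [hasCardinalLT_iff_of_equiv (equivShrink.{w} _), hasCardinalLT_iff_cardinal_mk_lt,
      Order.lt_succ_iff]
    exact he.trans hmc
  have : Fact (Order.succ c).IsRegular := ⟨Cardinal.isRegular_succ hc⟩
  have : IsCardinalPresentable G (Order.succ c) := isCardinalPresentable_of_le G
    (((le_max_left _ _).trans (le_max_right _ _)).trans (hmc.trans (Order.le_succ c)))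
  have hA : IsCardinalLocallyPresentable A (Order.succ c) :=
    (IsCardinalLocallyPresentable.iff_exists_isStrongGenerator _ _).2
      ⟨.singleton G, inferInstance, IsGrothendieckAbelian.isStrongGenerator_singleton hG,
        by simpa [isCardinalPresentable_iff]⟩
  exact ⟨⟨_, _, hA⟩, _, inferInstance, hA,
    IsGrothendieckAbelian.nonempty_abelian_isCardinalPresentable hG hc hE hE'⟩
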